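/- All Banach spaces are complex, and all linear and bilinear maps are bounded. For Banach spaces $X,Y$ let $\mathcal A(X,Y)$ be the space of approximable operators $X\to Y$, i.e. the operator-norm closure of the finite rank operators, and let $\mathcal A(X)=\mathcal A(X,X)$, a Banach algebra under composition. For a Banach algebra $\mathfrak A$ (not necessarily unital), a Banach right $\mathfrak A$-module $P$ and a Banach left $\mathfrak A$-module $Q$, let $P\widehat\otimes_{\mathfrak A}Q=(P\widehat\otimes Q)/N$, where $\widehat\otimes$ is the projective tensor product and $N$ is the closed linear span of $\{p.a\otimes q-p\otimes a.q : p\in P,\ q\in Q,\ a\in\mathfrak A\}$. The algebra $\mathfrak A$ is self-induced if multiplication implements an isomorphism $\mathfrak A\widehat\otimes_{\mathfrak A}\mathfrak A\to\mathfrak A$. Self-induced Banach algebras $\mathfrak A,\mathfrak B$ are Morita equivalent if there are a Banach $\mathfrak A$-$\mathfrak B$-bimodule $P$, a Banach $\mathfrak B$-$\mathfrak A$-bimodule $Q$, and balanced bilinear maps $\{\cdot,\cdot\}\colon P\times Q\to\mathfrak A$ and $[\cdot,\cdot]\colon Q\times P\to\mathfrak B$ which satisfy $\{p,q\}p'=p[q,p']$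 and $[q,p]q'=q\{p,q'\}$ for all $p,p'\in P$, $q,q'\in Q$, and which implement bimodule isomorphisms $P\widehat\otimes_{\mathfrak B}Q\cong\mathfrak A$ and $Q\widehat\otimes_{\mathfrak A}P\cong\mathfrak B$. **Theorem 3.2.** Let $X$ and $Y$ be Banach spaces such that $\mathcal A(X)$ and $\mathcal A(Y)$ are self-induced. Then $\mathcal A(X)$ and $\mathcal A(Y)$ are Morita equivalent if and only if composition of operators implements surjections $$\mathcal A(X,Y)\,\widehat\otimes\,\mathcal A(Y,X)\to\mathcal A(Y)\quad\text{and}\quad \mathcal A(Y,X)\,\widehat\otimes\,\mathcal A(X,Y)\to\mathcal A(X).$$ -/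

import Mathlib

open scoped TensorProduct

namespace BanachMorita

universe u v w

noncomputable section

/-! ### The projective tensor product of Banach spaces -/

section Projective

/-- The algebraic tensor product `P ⊗ Q`, as a type of its own that carries the projective
seminorm. -/
def AlgTensor (P : Type u) (Q : Type v) [NormedAddCommGroup P] [NormedSpace ℂ P]
    [NormedAddCommGroup Q] [NormedSpace ℂ Q] : Type (max u v) :=
  P ⊗[ℂ] Q

variable (P : Type u) (Q : Type v) [NormedAddCommGroup P] [NormedSpace ℂ P]
  [NormedAddCommGroup Q] [NormedSpace ℂ Q]

instance : AddCommGroup (AlgTensor P Q) := inferInstanceAs (AddCommGroup (P ⊗[ℂ] Q))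

instance : Module ℂ (AlgTensor P Q) := inferInstanceAs (Module ℂ (P ⊗[ℂ] Q))

variable {P Q}

/-- The elementary tensor `p ⊗ q` in the algebraic tensor product. -/
def atmul (p : P) (q : Q) : AlgTensor P Q := p ⊗ₜ[ℂ] q

/-- The tensor `∑ pᵢ ⊗ qᵢ` represented by a finite list of pairs. -/
def repSum (l : List (P × Q)) : AlgTensor P Q :=
  (l.map fun x => atmul x.1 x.2).sum

/-- The cost `∑ ‖pᵢ‖ ‖qᵢ‖` of a finite list of pairs. -/
def repCost (l : List (P × Q)) : ℝ :=
  (l.map fun x => ‖x.1‖ * ‖x.2‖).sum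

/-- The projective seminorm `π(t) = inf {∑ ‖pᵢ‖ ‖qᵢ‖ : t = ∑ pᵢ ⊗ qᵢ}`. -/
def projNorm (t : AlgTensor P Q) : ℝ :=
  sInf {r : ℝ | ∃ l : List (P × Q), repSum l = t ∧ repCost l = r}

set_option linter.unusedSectionVars false in
theorem repCost_nonneg (l : List (P × Q)) : 0 ≤ repCost l := by
  refine List.sum_nonneg fun r hr => ?_
  obtain ⟨x, -, rfl⟩ := List.mem_map.1 hr
  positivity

theorem projNorm_le (l : List (P × Q)) : projNorm (repSum l) ≤ repCost l :=
  csInf_le ⟨0, by rintro _ ⟨l, -, rfl⟩; exact repCost_nonneg l⟩ ⟨l, rfl, rfl⟩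

theorem exists_rep (t : AlgTensor P Q) : ∃ l : List (P × Q), repSum l = t := by
  refine TensorProduct.induction_on (motive := fun t : P ⊗[ℂ] Q =>
    ∃ l : List (P × Q), repSum l = (t : AlgTensor P Q)) t ⟨[], rfl⟩ ?_ ?_
  · intro p q
    refine ⟨[(p, q)], ?_⟩
    simp only [repSum, List.map_cons, List.map_nil, List.sum_cons, List.sum_nil]
    exact add_zero (atmul p q)
  · rintro s t ⟨l, hl⟩ ⟨m, hm⟩
    refine ⟨l ++ m, ?_⟩
    rw [← hl, ← hm]
    simp only [repSum, List.map_append, List.sum_append]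
    rfl

theorem exists_rep_lt (t : AlgTensor P Q) {ε : ℝ} (hε : 0 < ε) :
    ∃ l : List (P × Q), repSum l = t ∧ repCost l < projNorm t + ε := by
  obtain ⟨l₀, hl₀⟩ := exists_rep t
  obtain ⟨_, ⟨l, hl, rfl⟩, hlt⟩ := exists_lt_of_csInf_lt
    (s := {r : ℝ | ∃ l : List (P × Q), repSum l = t ∧ repCost l = r})
    ⟨_, l₀, hl₀, rfl⟩ (show sInf _ < projNorm t + ε from lt_add_of_pos_right _ hε)
  exact ⟨l, hl, hlt⟩

variable (P Q)

/-- The projective seminorm, bundled. -/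
def projSeminorm : Seminorm ℂ (AlgTensor P Q) :=
  Seminorm.ofSMulLE projNorm
    (le_antisymm (projNorm_le (P := P) (Q := Q) [])
      (Real.sInf_nonneg (by rintro _ ⟨l, -, rfl⟩; exact repCost_nonneg l)))
    (by
      intro s t
      refine le_of_forall_pos_lt_add fun ε hε => ?_
      obtain ⟨l, hl, hl'⟩ := exists_rep_lt s (half_pos hε)
      obtain ⟨m, hm, hm'⟩ := exists_rep_lt t (half_pos hε)
      have h1 : repSum (l ++ m) = s + t := by
        rw [← hl, ← hm]
        simp only [repSum, List.map_append, List.sum_append]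
      have h2 : repCost (l ++ m) = repCost l + repCost m := by
        simp [repCost]
      have h3 := projNorm_le (l ++ m)
      rw [h1, h2] at h3
      linarith)
    (by
      intro c t
      have key : ∀ l : List (P × Q), repSum l = t → projNorm (c • t) ≤ ‖c‖ * repCost l := by
        intro l hl
        have h1 : repSum (l.map fun x => (c • x.1, x.2)) = c • t := by
          rw [← hl]
          simp only [repSum, List.map_map]
          refine Eq.trans ?_ (List.smul_sum (r := c) (l := l.map fun x => atmul x.1 x.2)).symm
          rw [List.map_map]
          exact congrArg List.sum (List.map_congr_left fun x _ => rfl)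
        have h2 : repCost (l.map fun x => (c • x.1, x.2)) = ‖c‖ * repCost l := by
          simp only [repCost, List.map_map]
          rw [← List.sum_map_mul_left]
          congr 1
          refine List.map_congr_left fun x _ => ?_
          simp [norm_smul, mul_assoc]
        rw [← h1, ← h2]
        exact projNorm_le _
      refine le_of_forall_pos_lt_add fun ε hε => ?_
      have hc : 0 < ‖c‖ + 1 := by positivity
      obtain ⟨l, hl, hl'⟩ := exists_rep_lt t (div_pos hε hc)
      have h3 := key l hl
      have h4 : ‖c‖ * repCost l ≤ ‖c‖ * (projNorm t + ε / (‖c‖ + 1)) :=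
        mul_le_mul_of_nonneg_left hl'.le (norm_nonneg c)
      have h5 : ‖c‖ * (ε / (‖c‖ + 1)) < ε := by
        rw [← mul_div_assoc, div_lt_iff₀ hc]
        nlinarith
      rw [mul_add] at h4
      linarith)

instance : SeminormedAddCommGroup (AlgTensor P Q) :=
  AddGroupSeminorm.toSeminormedAddCommGroup (projSeminorm P Q).toAddGroupSeminorm

theorem norm_eq_projNorm (t : AlgTensor P Q) : ‖t‖ = projNorm t := rfl

instance : NormedSpace ℂ (AlgTensor P Q) where
  norm_smul_le c t := (map_smul_eq_mul (projSeminorm P Q) c t).le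

/-- The projective tensor product `P ⊗̂ Q`: the completion of `P ⊗ Q` in the projective norm. -/
abbrev ProjTensor : Type (max u v) := UniformSpace.Completion (AlgTensor P Q)

variable {P Q}

/-- The elementary tensor `p ⊗ q` in `P ⊗̂ Q`. -/
def ptmul (p : P) (q : Q) : ProjTensor P Q :=
  (atmul p q : AlgTensor P Q)

variable {Z : Type w} [NormedAddCommGroup Z] [NormedSpace ℂ Z]

/-- The linear map on the algebraic tensor product implemented by a bilinear map. -/
def algLift (f : P →L[ℂ] Q →L[ℂ] Z) : AlgTensor P Q →ₗ[ℂ] Z :=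
  TensorProduct.lift
    (LinearMap.mk₂ ℂ (fun p q => f p q) (by simp) (by simp) (by simp) (by simp))

theorem algLift_repSum (f : P →L[ℂ] Q →L[ℂ] Z) (l : List (P × Q)) :
    algLift f (repSum l) = (l.map fun x => f x.1 x.2).sum := by
  induction l with
  | nil => exact map_zero (algLift f)
  | cons x l ih =>
    have h : repSum (x :: l) = atmul x.1 x.2 + repSum l := rfl
    rw [List.map_cons, List.sum_cons, ← ih]
    exact (map_add (algLift f) _ _).trans rfl

theorem norm_algLift_le (f : P →L[ℂ] Q →L[ℂ] Z) (t : AlgTensor P Q) :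
    ‖algLift f t‖ ≤ ‖f‖ * ‖t‖ := by
  have key : ∀ l : List (P × Q), ‖(l.map fun x => f x.1 x.2).sum‖ ≤ ‖f‖ * repCost l := by
    intro l
    induction l with
    | nil => simp [repCost]
    | cons x l ih =>
      have h2 : repCost (x :: l) = ‖x.1‖ * ‖x.2‖ + repCost l := rfl
      rw [List.map_cons, List.sum_cons, h2, mul_add, ← mul_assoc]
      exact (norm_add_le _ _).trans (add_le_add (f.le_opNorm₂ _ _) ih)
  refine le_of_forall_pos_lt_add fun ε hε => ?_
  have hc : 0 < ‖f‖ + 1 := by positivity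
  obtain ⟨l, hl, hl'⟩ := exists_rep_lt t (div_pos hε hc)
  have h3 := key l
  rw [← algLift_repSum, hl] at h3
  have h4 : ‖f‖ * repCost l ≤ ‖f‖ * (projNorm t + ε / (‖f‖ + 1)) :=
    mul_le_mul_of_nonneg_left hl'.le (norm_nonneg f)
  have h5 : ‖f‖ * (ε / (‖f‖ + 1)) < ε := by
    rw [← mul_div_assoc, div_lt_iff₀ hc]
    nlinarith [norm_nonneg f]
  rw [mul_add] at h4
  rw [norm_eq_projNorm]
  linarith

/-- The bounded linear map `P ⊗̂ Q → Z` implemented by a bounded bilinear map `P × Q → Z`. -/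
def projLift [CompleteSpace Z] (f : P →L[ℂ] Q →L[ℂ] Z) : ProjTensor P Q →L[ℂ] Z :=
  ((algLift f).mkContinuous ‖f‖ (norm_algLift_le f)).extend
    (UniformSpace.Completion.toComplL (𝕜 := ℂ) (E := AlgTensor P Q))

@[simp]
theorem projLift_ptmul [CompleteSpace Z] (f : P →L[ℂ] Q →L[ℂ] Z) (p : P) (q : Q) :
    projLift f (ptmul p q) = f p q :=
  ContinuousLinearMap.extend_eq _ (e := UniformSpace.Completion.toComplL)
    UniformSpace.Completion.denseRange_coe
    (UniformSpace.Completion.isUniformInducing_coe _) (atmul p q)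

end Projective

/-! ### Banach modules and the balanced projective tensor product

A Banach algebra (not necessarily unital) is a type `A` with `[NonUnitalNormedRing A]
[NormedSpace ℂ A] [IsScalarTower ℂ A A] [SMulCommClass ℂ A A] [CompleteSpace A]`. -/

section Modules

/-- The structure of a Banach left `A`-module on `P`: a bounded bilinear associative action,
`act a p = a.p`. -/
structure LeftBanachModule (A : Type u) (P : Type v)
    [NonUnitalNormedRing A] [NormedSpace ℂ A]
    [NormedAddCommGroup P] [NormedSpace ℂ P] where
  /-- the left action -/
  lact : A →L[ℂ] P →L[ℂ] P
  lact_mul : ∀ a a' p, lact (a * a') p = lact a (lact a' p)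

/-- The structure of a Banach right `A`-module on `P`: a bounded bilinear associative action,
`ract p a = p.a`. -/
structure RightBanachModule (A : Type u) (P : Type v)
    [NonUnitalNormedRing A] [NormedSpace ℂ A]
    [NormedAddCommGroup P] [NormedSpace ℂ P] where
  /-- the right action -/
  ract : P →L[ℂ] A →L[ℂ] P
  ract_mul : ∀ p a a', ract p (a * a') = ract (ract p a) a'

/-- The structure of a Banach `A`-`B`-bimodule on `P`. -/
structure BanachBimodule (A : Type u) (B : Type v) (P : Type w)
    [NonUnitalNormedRing A] [NormedSpace ℂ A] [NonUnitalNormedRing B] [NormedSpace ℂ B]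
    [NormedAddCommGroup P] [NormedSpace ℂ P]
    extends LeftBanachModule A P, RightBanachModule B P where
  lact_ract : ∀ a p b, lact a (ract p b) = ract (lact a p) b

variable {A : Type*} [NonUnitalNormedRing A] [NormedSpace ℂ A]

variable {P : Type u} {Q : Type v} [NormedAddCommGroup P] [NormedSpace ℂ P]
  [NormedAddCommGroup Q] [NormedSpace ℂ Q]

/-- The closed linear span `N` of the tensors `p.a ⊗ q - p ⊗ a.q` in `P ⊗̂ Q`. -/
def balancedKer (M : RightBanachModule A P) (N : LeftBanachModule A Q) :
    Submodule ℂ (ProjTensor P Q) :=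
  (Submodule.span ℂ
    {t | ∃ p a q, t = ptmul (M.ract p a) q - ptmul p (N.lact a q)}).topologicalClosure

instance (M : RightBanachModule A P) (N : LeftBanachModule A Q) :
    IsClosed (balancedKer M N : Set (ProjTensor P Q)) :=
  Submodule.isClosed_topologicalClosure _

/-- The balanced projective tensor product `P ⊗̂_A Q = (P ⊗̂ Q) / N`. -/
abbrev BalancedTensor (M : RightBanachModule A P) (N : LeftBanachModule A Q) :
    Type (max u v) :=
  ProjTensor P Q ⧸ balancedKer M N

/-- The bounded linear map `P ⊗̂_A Q → Z` implemented by a bounded `A`-balanced bilinear map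
`P × Q → Z`. -/
def balancedLift (M : RightBanachModule A P) (N : LeftBanachModule A Q)
    {Z : Type w} [NormedAddCommGroup Z] [NormedSpace ℂ Z] [CompleteSpace Z]
    (f : P →L[ℂ] Q →L[ℂ] Z) (hf : ∀ p a q, f (M.ract p a) q = f p (N.lact a q)) :
    BalancedTensor M N →L[ℂ] Z :=
  (balancedKer M N).liftQL (projLift f)
    (Submodule.topologicalClosure_minimal _
      (Submodule.span_le.2 (by rintro _ ⟨p, a, q, rfl⟩; simp [hf]))
      (projLift f).isClosed_ker)

variable (A) [IsScalarTower ℂ A A] [SMulCommClass ℂ A A]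

/-- `A` as a Banach left module over itself. -/
def LeftBanachModule.self : LeftBanachModule A A where
  lact := ContinuousLinearMap.mul ℂ A
  lact_mul a a' p := mul_assoc a a' p

/-- `A` as a Banach right module over itself. -/
def RightBanachModule.self : RightBanachModule A A where
  ract := ContinuousLinearMap.mul ℂ A
  ract_mul p a a' := (mul_assoc p a a').symm

/-- The map `μ_A : A ⊗̂_A A → A` implemented by multiplication. -/
def mulMap [CompleteSpace A] :
    BalancedTensor (RightBanachModule.self A) (LeftBanachModule.self A) →L[ℂ] A :=
  balancedLift _ _ (ContinuousLinearMap.mul ℂ A) (fun p a q => mul_assoc p a q)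

/-- `A` is self-induced: multiplication implements an isomorphism (of Banach spaces, hence of
Banach bimodules, as `μ_A` respects the actions) `A ⊗̂_A A ≅ A`. -/
def SelfInduced [CompleteSpace A] : Prop :=
  (mulMap A).IsInvertible

end Modules

/-! ### Morita contexts -/

section Morita

/-- A Morita context for the Banach algebras `A`, `B` on the Banach spaces `P`, `Q`: bimodule
structures `P ∈ A-mod-B`, `Q ∈ B-mod-A` with compatible pairings `{ , } : P × Q → A` and
`[ , ] : Q × P → B`. -/
structure MoritaContext (A B P Q : Type*)
    [NonUnitalNormedRing A] [NormedSpace ℂ A] [NonUnitalNormedRing B] [NormedSpace ℂ B]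
    [NormedAddCommGroup P] [NormedSpace ℂ P] [NormedAddCommGroup Q] [NormedSpace ℂ Q] where
  /-- `P` as an `A`-`B`-bimodule -/
  modP : BanachBimodule A B P
  /-- `Q` as a `B`-`A`-bimodule -/
  modQ : BanachBimodule B A Q
  /-- the pairing `{p, q}` -/
  pairA : P →L[ℂ] Q →L[ℂ] A
  /-- the pairing `[q, p]` -/
  pairB : Q →L[ℂ] P →L[ℂ] B
  /-- `{ , }` is `B`-balanced -/
  pairA_balanced : ∀ p b q, pairA (modP.ract p b) q = pairA p (modQ.lact b q)
  /-- `[ , ]` is `A`-balanced -/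
  pairB_balanced : ∀ q a p, pairB (modQ.ract q a) p = pairB q (modP.lact a p)
  /-- `{ , }` implements a homomorphism of `A`-bimodules -/
  pairA_left : ∀ a p q, pairA (modP.lact a p) q = a * pairA p q
  pairA_right : ∀ p q a, pairA p (modQ.ract q a) = pairA p q * a
  /-- `[ , ]` implements a homomorphism of `B`-bimodules -/
  pairB_left : ∀ b q p, pairB (modQ.lact b q) p = b * pairB q p
  pairB_right : ∀ q p b, pairB q (modP.ract p b) = pairB q p * b
  /-- `{p, q} p' = p [q, p']` -/
  compat_P : ∀ p q p', modP.lact (pairA p q) p' = modP.ract p (pairB q p')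
  /-- `[q, p] q' = q {p, q'}` -/
  compat_Q : ∀ q p q', modQ.lact (pairB q p) q' = modQ.ract q (pairA p q')

namespace MoritaContext

variable {A B P Q : Type*}
  [NonUnitalNormedRing A] [NormedSpace ℂ A] [CompleteSpace A]
  [NonUnitalNormedRing B] [NormedSpace ℂ B] [CompleteSpace B]
  [NormedAddCommGroup P] [NormedSpace ℂ P] [NormedAddCommGroup Q] [NormedSpace ℂ Q]

/-- The map `P ⊗̂_B Q → A` implemented by `{ , }`. -/
def mapA (M : MoritaContext A B P Q) :
    BalancedTensor M.modP.toRightBanachModule M.modQ.toLeftBanachModule →L[ℂ] A :=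
  balancedLift _ _ M.pairA M.pairA_balanced

/-- The map `Q ⊗̂_A P → B` implemented by `[ , ]`. -/
def mapB (M : MoritaContext A B P Q) :
    BalancedTensor M.modQ.toRightBanachModule M.modP.toLeftBanachModule →L[ℂ] B :=
  balancedLift _ _ M.pairB M.pairB_balanced

/-- The Morita context is full: both pairings implement isomorphisms (they are always bimodule
homomorphisms). -/
def IsFull (M : MoritaContext A B P Q) : Prop :=
  M.mapA.IsInvertible ∧ M.mapB.IsInvertible

end MoritaContext

/-- Morita equivalence of (self-induced) Banach algebras: there are Banach bimodules `P`, `Q` and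
compatible pairings constituting a full Morita context. -/
def MoritaEquivalent (A : Type u) (B : Type v)
    [NonUnitalNormedRing A] [NormedSpace ℂ A] [CompleteSpace A]
    [NonUnitalNormedRing B] [NormedSpace ℂ B] [CompleteSpace B] : Prop :=
  ∃ (P Q : Type (max u v))
    (_ : NormedAddCommGroup P) (_ : NormedSpace ℂ P) (_ : CompleteSpace P)
    (_ : NormedAddCommGroup Q) (_ : NormedSpace ℂ Q) (_ : CompleteSpace Q)
    (M : MoritaContext A B P Q), M.IsFull

end Morita

/-! ### Approximable operators -/

section Approximable

variable (X : Type u) (Y : Type v) [NormedAddCommGroup X] [NormedSpace ℂ X]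
  [NormedAddCommGroup Y] [NormedSpace ℂ Y]

/-- The finite rank operators `X → Y`. -/
def finiteRank : Submodule ℂ (X →L[ℂ] Y) where
  carrier := {T | FiniteDimensional ℂ (LinearMap.range (T : X →ₗ[ℂ] Y))}
  zero_mem' := by
    refine Submodule.finiteDimensional_of_le (S₂ := (⊥ : Submodule ℂ Y)) ?_
    rintro _ ⟨x, rfl⟩
    simp
  add_mem' := by
    intro S T hS hT
    simp only [Set.mem_ofPred_eq] at hS hT ⊢
    refine Submodule.finiteDimensional_of_le
      (S₂ := LinearMap.range (S : X →ₗ[ℂ] Y) ⊔ LinearMap.range (T : X →ₗ[ℂ] Y)) ?_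
    rintro _ ⟨x, rfl⟩
    exact Submodule.add_mem_sup ⟨x, rfl⟩ ⟨x, rfl⟩
  smul_mem' := by
    intro c T hT
    simp only [Set.mem_ofPred_eq] at hT ⊢
    refine Submodule.finiteDimensional_of_le (S₂ := LinearMap.range (T : X →ₗ[ℂ] Y)) ?_
    rintro _ ⟨x, rfl⟩
    exact ⟨c • x, map_smul T c x⟩

/-- The closed subspace of approximable operators `X → Y`: the operator-norm closure of the finite
rank operators. -/
def approximable : Submodule ℂ (X →L[ℂ] Y) := (finiteRank X Y).topologicalClosure

/-- The Banach space `𝒜(X, Y)` of approximable operators with the operator norm. -/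
abbrev Approx : Type (max u v) := ↥(approximable X Y)

instance [CompleteSpace Y] : CompleteSpace (Approx X Y) :=
  (Submodule.isClosed_topologicalClosure (finiteRank X Y)).completeSpace_coe

variable {X Y} {Z : Type w} [NormedAddCommGroup Z] [NormedSpace ℂ Z]

theorem comp_mem_approximable {S : Y →L[ℂ] Z} (hS : S ∈ approximable Y Z) (T : X →L[ℂ] Y) :
    S.comp T ∈ approximable X Z := by
  refine map_mem_closure (f := fun S : Y →L[ℂ] Z => S.comp T)
    (((ContinuousLinearMap.compL ℂ X Y Z).flip T).continuous) hS ?_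
  intro S hS
  have hS' : FiniteDimensional ℂ (LinearMap.range (S : Y →ₗ[ℂ] Z)) := hS
  refine Submodule.finiteDimensional_of_le (S₂ := LinearMap.range (S : Y →ₗ[ℂ] Z)) ?_
  rintro _ ⟨x, rfl⟩
  exact ⟨T x, rfl⟩

variable (X Y Z)

/-- Composition `(S, T) ↦ S ∘ T` as a bounded bilinear map `𝒜(Y, Z) × 𝒜(X, Y) → 𝒜(X, Z)`. -/
def approxComp : Approx Y Z →L[ℂ] Approx X Y →L[ℂ] Approx X Z :=
  LinearMap.mkContinuous₂
    (LinearMap.mk₂ ℂ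
      (fun (S : Approx Y Z) (T : Approx X Y) =>
        (⟨S.1.comp T.1, comp_mem_approximable S.2 T.1⟩ : Approx X Z))
      (by intro S S' T; ext x; simp) (by intro c S T; ext x; simp)
      (by intro S T T'; ext x; simp) (by intro c S T; ext x; simp))
    1 (by intro S T; rw [one_mul]; exact S.1.opNorm_comp_le T.1)

@[simp]
theorem coe_approxComp (S : Approx Y Z) (T : Approx X Y) :
    (approxComp X Y Z S T : X →L[ℂ] Z) = (S : Y →L[ℂ] Z).comp (T : X →L[ℂ] Y) := rfl

/-- The algebra `𝒜(X) = 𝒜(X, X)` under composition and the operator norm. -/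
instance : NonUnitalNormedRing (Approx X X) where
  __ := (inferInstance : NormedAddCommGroup (Approx X X))
  mul S T := approxComp X X X S T
  left_distrib S T T' := map_add (approxComp X X X S) T T'
  right_distrib S S' T := by
    change approxComp X X X (S + S') T = approxComp X X X S T + approxComp X X X S' T
    simp
  zero_mul T := by
    change approxComp X X X 0 T = 0
    simp
  mul_zero S := map_zero (approxComp X X X S)
  mul_assoc _ _ _ := rfl
  norm_mul_le S T := S.1.opNorm_comp_le T.1

theorem approx_mul_def (S T : Approx X X) : S * T = approxComp X X X S T := rfl

instance : IsScalarTower ℂ (Approx X X) (Approx X X) where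
  smul_assoc c S T := by
    change approxComp X X X (c • S) T = c • approxComp X X X S T
    simp

instance : SMulCommClass ℂ (Approx X X) (Approx X X) where
  smul_comm c S T := ((approxComp X X X S).map_smul c T).symm

/-- The map `𝒜(Y, X) ⊗̂ 𝒜(X, Y) → 𝒜(X)` implemented by composition, `S ⊗ T ↦ S ∘ T`. -/
def compMap [CompleteSpace X] : ProjTensor (Approx Y X) (Approx X Y) →L[ℂ] Approx X X :=
  projLift (Z := Approx X X) (approxComp X Y X)

end Approximable

end

end BanachMorita

/-!
Suppose first that composition implements the two surjections. Then `𝒜(Y, X)` and `𝒜(X, Y)` with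
composition as actions and pairings form a Morita context (`operatorContext`), and only the
injectivity of `𝒜(Y, X) ⊗̂_{𝒜(Y)} 𝒜(X, Y) → 𝒜(X)` is in question. In any Morita context, `A`
annihilates the kernel of `P ⊗̂_B Q → A`. If that map is onto, `a.t` therefore depends only on `a`
and on the image of `t`, which defines a balanced bilinear map `A × A → P ⊗̂_B Q`; as `A` is
self-induced it yields an operator `A → P ⊗̂_B Q`, which is a left inverse on `A.(P ⊗̂_B Q)`
(`MoritaContext.mapA_isInvertible`). The latter is dense because every finite rank operator is
fixed by composition with a finite rank projection (`approxComp_span_dense`).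

Conversely, let `P`, `Q` be a full Morita context for `𝒜(X)` and `𝒜(Y)`. A rank one idempotent `u`
of `𝒜(Y)` satisfies `u 𝒜(Y) u = ℂ u`, and so has the form `[q, p]`. The element `{p, q}` of `𝒜(X)`
is then an idempotent with the same property, hence also of rank one. These two idempotents identify
`Y` with `𝒜(Y) u` and `X` with `𝒜(X) {p, q}`, whereby elements of `Q` and `P` act as operators
`X → Y` and `Y → X`, and `[q', p']` is the composite of the operators of `q'` and `p'`
(`MoritaContext.exists_pairB_eq_comp`). These operators become approximable when composed with
elements of `𝒜(Y)`, so the range of composition contains all `b₁ [q', p'] b₃`. Since a bilinear map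
with values in the range of an operator on a Banach space implements a map with values in that range
(`projLift_mem_range`, by the closed graph theorem), the range of composition is all of `𝒜(Y)`
(`SelfInduced.surjective_of_mul_mem_range`).
-/

namespace BanachMorita

/-! ### Lifting and factoring bounded linear and bilinear maps -/

section Factorization

variable {U V W Z : Type*} [NormedAddCommGroup U] [NormedSpace ℂ U] [CompleteSpace U]
  [NormedAddCommGroup V] [NormedSpace ℂ V] [CompleteSpace V]
  [NormedAddCommGroup W] [NormedSpace ℂ W] [CompleteSpace W]
  [NormedAddCommGroup Z] [NormedSpace ℂ Z]

/-- A bounded operator `T` that vanishes on the kernel of a surjection `π` between Banach spaces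
factors boundedly through `π`: surjections are quotient maps by the open mapping theorem. -/
theorem exists_factor_of_surjective {π : U →L[ℂ] V} (hπ : Function.Surjective π) (T : U →L[ℂ] Z)
    (h : ∀ x, π x = 0 → T x = 0) : ∃ S : V →L[ℂ] Z, ∀ x, S (π x) = T x := by
  choose τ hτ using hπ
  have key : ∀ x y, π x = π y → T x = T y := fun x y hxy => by
    rw [← sub_eq_zero, ← map_sub]
    exact h _ (by rw [map_sub, hxy, sub_self])
  have hS : ∀ x, T (τ (π x)) = T x := fun x => key _ _ (hτ _)
  refine ⟨⟨⟨⟨fun z => T (τ z), fun a b => ?_⟩, fun c a => ?_⟩, ?_⟩, hS⟩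
  · rw [← map_add]
    exact key _ _ (by simp [hτ])
  · rw [RingHom.id_apply, ← map_smul]
    exact key _ _ (by simp [hτ])
  · refine (π.isQuotientMap fun z => ⟨τ z, hτ z⟩).continuous_iff.2 ?_
    exact T.continuous.congr fun x => (hS x).symm

/-- A bounded operator with values in the range of an injective operator `S` on a Banach space
factors boundedly through `S`, by the closed graph theorem. -/
theorem exists_lift_of_injective {S : W →L[ℂ] Z} (hS : Function.Injective S) (T : V →L[ℂ] Z)
    (h : ∀ v, ∃ w, S w = T v) : ∃ R : V →L[ℂ] W, ∀ v, S (R v) = T v := by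
  choose r hr using h
  let R : V →ₗ[ℂ] W :=
    { toFun := r
      map_add' := fun a b => hS (by simp [hr])
      map_smul' := fun c a => hS (by simp [hr]) }
  refine ⟨ContinuousLinearMap.ofSeqClosedGraph (g := R) fun s x y hs hy => hS ?_, hr⟩
  have h1 : Filter.Tendsto (fun n => S (R (s n))) Filter.atTop (nhds (S y)) :=
    (S.continuous.tendsto y).comp hy
  have h2 : Filter.Tendsto (fun n => S (R (s n))) Filter.atTop (nhds (T x)) :=
    ((T.continuous.tendsto x).comp hs).congr fun n => (hr _).symm
  exact (tendsto_nhds_unique h1 h2).trans (hr x).symm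

/-- The bilinear form of `exists_lift_of_injective`: the closed graph theorem also gives the
boundedness of `u ↦ R u`. -/
theorem exists_bilinear_lift_of_injective {S : W →L[ℂ] Z} (hS : Function.Injective S)
    (f : U →L[ℂ] V →L[ℂ] Z) (h : ∀ u v, ∃ w, S w = f u v) :
    ∃ R : U →L[ℂ] V →L[ℂ] W, ∀ u v, S (R u v) = f u v := by
  choose r hr using fun u => exists_lift_of_injective hS (f u) (h u)
  let R : U →ₗ[ℂ] V →L[ℂ] W :=
    { toFun := r
      map_add' := fun a b => by ext v; exact hS (by simp [hr])
      map_smul' := fun c a => by ext v; exact hS (by simp [hr]) }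
  refine ⟨ContinuousLinearMap.ofSeqClosedGraph (g := R) fun s x y hs hy => ?_, hr⟩
  ext v
  apply hS
  have h1 : Filter.Tendsto (fun n => S (R (s n) v)) Filter.atTop (nhds (S (y v))) :=
    ((S.comp (ContinuousLinearMap.apply ℂ W v)).continuous.tendsto y).comp hy
  have h2 : Filter.Tendsto (fun n => S (R (s n) v)) Filter.atTop (nhds (f x v)) :=
    (((f.flip v).continuous.tendsto x).comp hs).congr fun n => (hr _ _).symm
  exact (tendsto_nhds_unique h1 h2).trans (hr x v).symm

end Factorization

/-! ### The universal properties of the projective tensor products -/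

section Tensor

variable {P Q Z : Type*} [NormedAddCommGroup P] [NormedSpace ℂ P]
  [NormedAddCommGroup Q] [NormedSpace ℂ Q] [NormedAddCommGroup Z] [NormedSpace ℂ Z]

theorem norm_ptmul_le (p : P) (q : Q) : ‖ptmul p q‖ ≤ ‖p‖ * ‖q‖ := by
  have h := projNorm_le [(p, q)]
  simp only [repSum, repCost, List.map_cons, List.map_nil, List.sum_cons, List.sum_nil,
    add_zero] at h
  rw [ptmul, UniformSpace.Completion.norm_coe]
  exact h

variable (P Q) in
/-- The elementary tensor `(p, q) ↦ p ⊗ q` as a bounded bilinear map. -/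
noncomputable def ptmulL : P →L[ℂ] Q →L[ℂ] ProjTensor P Q :=
  LinearMap.mkContinuous₂
    (LinearMap.mk₂ ℂ (fun p q => ptmul p q)
      (fun p p' q => by
        rw [ptmul, ptmul, ptmul, ← UniformSpace.Completion.coe_add]
        exact congrArg _ (TensorProduct.add_tmul p p' q))
      (fun c p q => by
        rw [ptmul, ptmul, ← UniformSpace.Completion.coe_smul]
        exact congrArg _ (TensorProduct.smul_tmul' c p q).symm)
      (fun p q q' => by
        rw [ptmul, ptmul, ptmul, ← UniformSpace.Completion.coe_add]
        exact congrArg _ (TensorProduct.tmul_add p q q'))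
      (fun c p q => by
        rw [ptmul, ptmul, ← UniformSpace.Completion.coe_smul]
        exact congrArg _ (TensorProduct.tmul_smul c p q)))
    1 (fun p q => by rw [one_mul]; exact norm_ptmul_le p q)

/-- Bounded operators on `P ⊗̂ Q` that agree on elementary tensors are equal. -/
theorem projTensor_ext {S T : ProjTensor P Q →L[ℂ] Z}
    (h : ∀ p q, S (ptmul p q) = T (ptmul p q)) : S = T := by
  ext t
  induction t using UniformSpace.Completion.induction_on with
  | hp => exact isClosed_eq S.continuous T.continuous
  | ih a =>
    obtain ⟨l, rfl⟩ := exists_rep a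
    induction l with
    | nil => exact (map_zero S).trans (map_zero T).symm
    | cons x l ih =>
      have hx : ((repSum (x :: l) : AlgTensor P Q) : ProjTensor P Q)
          = ptmul x.1 x.2 + (repSum l : AlgTensor P Q) :=
        UniformSpace.Completion.coe_add (atmul x.1 x.2) (repSum l)
      rw [hx, map_add, map_add, h, ih]

/-- Let `f` be a bounded bilinear map and `κ` a bounded operator. If all `κ (f p q)` lie in the
range of an operator `S` on a Banach space, then so does the image under `κ` of the operator
implemented by `f` on the projective tensor product. No estimate on the preimages is needed. -/
theorem projLift_mem_range [CompleteSpace P] [CompleteSpace Q] [CompleteSpace Z]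
    {W Z' : Type*} [NormedAddCommGroup W] [NormedSpace ℂ W] [CompleteSpace W]
    [NormedAddCommGroup Z'] [NormedSpace ℂ Z'] [CompleteSpace Z']
    (S : W →L[ℂ] Z') (κ : Z →L[ℂ] Z') (f : P →L[ℂ] Q →L[ℂ] Z)
    (h : ∀ p q, ∃ w, S w = κ (f p q)) (t : ProjTensor P Q) : ∃ w, S w = κ (projLift f t) := by
  have : IsClosed (S.ker : Set W) := S.isClosed_ker
  -- Divide out the kernel of `S`: preimages become unique, hence bilinear in `(p, q)`.
  let S' : (W ⧸ S.ker) →L[ℂ] Z' := S.ker.liftQL S le_rfl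
  have hS' : Function.Injective S' :=
    LinearMap.ker_eq_bot (f := S'.toLinearMap) |>.1 (Submodule.ker_liftQ_eq_bot _ _ _ le_rfl)
  obtain ⟨g, hg⟩ := exists_bilinear_lift_of_injective hS'
    ((ContinuousLinearMap.compL ℂ Q Z Z' κ).comp f) fun p q => by
      obtain ⟨w, hw⟩ := h p q
      exact ⟨S.ker.mkQ w, hw⟩
  have hcomp : S'.comp (projLift g) = κ.comp (projLift f) :=
    projTensor_ext fun p q => by simp [hg]
  obtain ⟨w, hw⟩ := S.ker.mkQ_surjective (projLift g t)
  refine ⟨w, ?_⟩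
  rw [← ContinuousLinearMap.comp_apply, ← hcomp, ContinuousLinearMap.comp_apply, ← hw]
  rfl

variable {A : Type*} [NonUnitalNormedRing A] [NormedSpace ℂ A]
  (M : RightBanachModule A P) (N : LeftBanachModule A Q)

/-- The elementary tensor `(p, q) ↦ p ⊗ q` in `P ⊗̂_A Q`, as a bounded bilinear map. -/
noncomputable def btmul : P →L[ℂ] Q →L[ℂ] BalancedTensor M N :=
  (ContinuousLinearMap.compL ℂ Q (ProjTensor P Q) (BalancedTensor M N)
    (balancedKer M N).mkQL).comp (ptmulL P Q)

theorem btmul_apply (p : P) (q : Q) : btmul M N p q = (balancedKer M N).mkQ (ptmul p q) := rfl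

theorem btmul_ract (p : P) (a : A) (q : Q) :
    btmul M N (M.ract p a) q = btmul M N p (N.lact a q) := by
  rw [btmul_apply, btmul_apply, ← sub_eq_zero, ← map_sub, Submodule.mkQ_apply,
    Submodule.Quotient.mk_eq_zero]
  exact Submodule.le_topologicalClosure _ (Submodule.subset_span ⟨p, a, q, rfl⟩)

variable {M N}

/-- Bounded operators on `P ⊗̂_A Q` that agree on elementary tensors are equal. -/
theorem balancedTensor_ext {S T : BalancedTensor M N →L[ℂ] Z}
    (h : ∀ p q, S (btmul M N p q) = T (btmul M N p q)) : S = T := by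
  have h' : S.comp (balancedKer M N).mkQL = T.comp (balancedKer M N).mkQL :=
    projTensor_ext h
  ext t
  obtain ⟨t, rfl⟩ := (balancedKer M N).mkQ_surjective t
  exact DFunLike.congr_fun h' t

variable [CompleteSpace Z] {f : P →L[ℂ] Q →L[ℂ] Z}
  (hf : ∀ p a q, f (M.ract p a) q = f p (N.lact a q))

@[simp]
theorem balancedLift_btmul (p : P) (q : Q) : balancedLift M N f hf (btmul M N p q) = f p q :=
  projLift_ptmul f p q

theorem balancedLift_surjective_iff :
    Function.Surjective (balancedLift M N f hf) ↔ Function.Surjective (projLift f) :=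
  ⟨fun h z => by
    obtain ⟨t, rfl⟩ := h z
    obtain ⟨t, rfl⟩ := (balancedKer M N).mkQ_surjective t
    exact ⟨t, rfl⟩, fun h z => by
    obtain ⟨t, rfl⟩ := h z
    exact ⟨(balancedKer M N).mkQ t, rfl⟩⟩

end Tensor

/-! ### Surjective pairings over a self-induced algebra -/

namespace MoritaContext

variable {A B P Q : Type*}
  [NonUnitalNormedRing A] [NormedSpace ℂ A]
  [NonUnitalNormedRing B] [NormedSpace ℂ B]
  [NormedAddCommGroup P] [NormedSpace ℂ P] [NormedAddCommGroup Q] [NormedSpace ℂ Q]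

/-- The Morita context with the roles of the two algebras exchanged. -/
def symm (M : MoritaContext A B P Q) : MoritaContext B A Q P where
  modP := M.modQ
  modQ := M.modP
  pairA := M.pairB
  pairB := M.pairA
  pairA_balanced := M.pairB_balanced
  pairB_balanced := M.pairA_balanced
  pairA_left := M.pairB_left
  pairA_right := M.pairB_right
  pairB_left := M.pairA_left
  pairB_right := M.pairA_right
  compat_P := M.compat_Q
  compat_Q := M.compat_P

/-- The space `P ⊗̂_B Q` of a Morita context. -/
abbrev TensorA (M : MoritaContext A B P Q) :=
  BalancedTensor M.modP.toRightBanachModule M.modQ.toLeftBanachModule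

/-- The elementary tensors of `P ⊗̂_B Q`. -/
noncomputable abbrev tmulA (M : MoritaContext A B P Q) : P →L[ℂ] Q →L[ℂ] M.TensorA :=
  btmul M.modP.toRightBanachModule M.modQ.toLeftBanachModule

theorem mapA_tmulA [CompleteSpace A] (M : MoritaContext A B P Q) (p : P) (q : Q) :
    M.mapA (M.tmulA p q) = M.pairA p q :=
  balancedLift_btmul M.pairA_balanced p q

/-- The left action of `A` on `P ⊗̂_B Q`, with the algebra element as second argument:
`leftA t a = a.t`. -/
noncomputable def leftA (M : MoritaContext A B P Q) : M.TensorA →L[ℂ] A →L[ℂ] M.TensorA :=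
  balancedLift M.modP.toRightBanachModule M.modQ.toLeftBanachModule (Z := A →L[ℂ] M.TensorA)
    (((ContinuousLinearMap.compL ℂ A P M.TensorA).comp M.tmulA.flip).flip.comp M.modP.lact.flip)
    fun p b q => by
      ext a
      change M.tmulA (M.modP.lact a (M.modP.ract p b)) q
        = M.tmulA (M.modP.lact a p) (M.modQ.lact b q)
      rw [M.modP.lact_ract]
      exact btmul_ract _ _ _ _ _

theorem leftA_tmulA (M : MoritaContext A B P Q) (p : P) (q : Q) (a : A) :
    M.leftA (M.tmulA p q) a = M.tmulA (M.modP.lact a p) q :=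
  DFunLike.congr_fun (balancedLift_btmul (Z := A →L[ℂ] M.TensorA) _ p q) a

/-- The right action of `A` on `P ⊗̂_B Q`: `rightA t a = t.a`. -/
noncomputable def rightA (M : MoritaContext A B P Q) : M.TensorA →L[ℂ] A →L[ℂ] M.TensorA :=
  balancedLift M.modP.toRightBanachModule M.modQ.toLeftBanachModule (Z := A →L[ℂ] M.TensorA)
    (((ContinuousLinearMap.compL ℂ A Q M.TensorA).comp M.tmulA).flip.comp M.modQ.ract).flip
    fun p b q => by
      ext a
      change M.tmulA (M.modP.ract p b) (M.modQ.ract q a)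
        = M.tmulA p (M.modQ.ract (M.modQ.lact b q) a)
      rw [← M.modQ.lact_ract]
      exact btmul_ract _ _ _ _ _

theorem rightA_tmulA (M : MoritaContext A B P Q) (p : P) (q : Q) (a : A) :
    M.rightA (M.tmulA p q) a = M.tmulA p (M.modQ.ract q a) :=
  DFunLike.congr_fun (balancedLift_btmul (Z := A →L[ℂ] M.TensorA) _ p q) a

theorem mapA_leftA [CompleteSpace A] [IsScalarTower ℂ A A] [SMulCommClass ℂ A A]
    (M : MoritaContext A B P Q) (t : M.TensorA) (a : A) :
    M.mapA (M.leftA t a) = a * M.mapA t := by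
  have h : M.mapA.comp (M.leftA.flip a) = (ContinuousLinearMap.mul ℂ A a).comp M.mapA := by
    refine balancedTensor_ext fun p q => ?_
    change M.mapA (M.leftA (M.tmulA p q) a) = a * M.mapA (M.tmulA p q)
    rw [leftA_tmulA, mapA_tmulA, mapA_tmulA, M.pairA_left]
  exact DFunLike.congr_fun h t

theorem leftA_mul (M : MoritaContext A B P Q) (t : M.TensorA) (a b : A) :
    M.leftA t (a * b) = M.leftA (M.leftA t b) a := by
  have h : M.leftA.flip (a * b) = (M.leftA.flip a).comp (M.leftA.flip b) := by
    refine balancedTensor_ext fun p q => ?_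
    change M.leftA (M.tmulA p q) (a * b) = M.leftA (M.leftA (M.tmulA p q) b) a
    rw [leftA_tmulA, leftA_tmulA, leftA_tmulA, M.modP.lact_mul]
  exact DFunLike.congr_fun h t

/-- The interchange law `{s}.t = s.{t}` in `P ⊗̂_B Q`, where `{·}` is the map to `A`. -/
theorem leftA_mapA [CompleteSpace A] (M : MoritaContext A B P Q) (s t : M.TensorA) :
    M.leftA t (M.mapA s) = M.rightA s (M.mapA t) := by
  have h : ∀ s p q, M.leftA (M.tmulA p q) (M.mapA s) = M.rightA s (M.mapA (M.tmulA p q)) := by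
    intro s p q
    have h' : (M.leftA (M.tmulA p q)).comp M.mapA
        = M.rightA.flip (M.mapA (M.tmulA p q)) := by
      refine balancedTensor_ext fun p' q' => ?_
      change M.leftA (M.tmulA p q) (M.mapA (M.tmulA p' q'))
        = M.rightA (M.tmulA p' q') (M.mapA (M.tmulA p q))
      rw [leftA_tmulA, rightA_tmulA, mapA_tmulA, mapA_tmulA, M.compat_P, ← M.compat_Q]
      exact btmul_ract _ _ _ _ _
    exact DFunLike.congr_fun h' s
  have h' : M.leftA.flip (M.mapA s) = (M.rightA s).comp M.mapA :=
    balancedTensor_ext (h s)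
  exact DFunLike.congr_fun h' t

/-- A surjective pairing `P ⊗̂_B Q → A` onto a self-induced Banach algebra is an isomorphism as
soon as `A.P` is dense in `P`.

By the interchange law `A` annihilates the kernel of the pairing, so that `a.t` depends only on
`a` and on the image of `t` in `A`. The resulting balanced bilinear map `A × A → P ⊗̂_B Q` and the
isomorphism `A ⊗̂_A A ≅ A` provide a left inverse. -/
theorem mapA_isInvertible [CompleteSpace A] (M : MoritaContext A B P Q)
    [IsScalarTower ℂ A A] [SMulCommClass ℂ A A] (hA : SelfInduced A)
    (hM : Function.Surjective M.mapA)
    (hP : (Submodule.span ℂ {p | ∃ a p', p = M.modP.lact a p'}).topologicalClosure = ⊤) :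
    M.mapA.IsInvertible := by
  obtain ⟨Φ, hΦ⟩ := exists_factor_of_surjective
    (Z := A →L[ℂ] M.TensorA) hM M.leftA fun t ht => by
    ext a
    obtain ⟨s, rfl⟩ := hM a
    rw [leftA_mapA, ht, map_zero]
    rfl
  -- `Φ.flip a b = a.t` for any `t` with image `b`
  have hbal : ∀ a b c, Φ.flip (a * b) c = Φ.flip a (b * c) := by
    intro a b c
    obtain ⟨t, rfl⟩ := hM c
    rw [← M.mapA_leftA, ContinuousLinearMap.flip_apply, ContinuousLinearMap.flip_apply, hΦ, hΦ,
      leftA_mul]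
  obtain ⟨μ, hμ⟩ := hA
  let σ : A →L[ℂ] M.TensorA :=
    (balancedLift (RightBanachModule.self A) (LeftBanachModule.self A) Φ.flip hbal).comp
      (μ.symm : A →L[ℂ] _)
  have hσ : ∀ a t, σ (a * M.mapA t) = M.leftA t a := by
    intro a t
    have h1 : a * M.mapA t = μ (btmul (RightBanachModule.self A) (LeftBanachModule.self A)
        a (M.mapA t)) := by
      rw [← ContinuousLinearEquiv.coe_coe, hμ]
      exact (balancedLift_btmul (M := RightBanachModule.self A) (N := LeftBanachModule.self A)
        (f := ContinuousLinearMap.mul ℂ A) (fun p b q => mul_assoc p b q) a (M.mapA t)).symm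
    have h2 : σ (a * M.mapA t) = Φ.flip a (M.mapA t) := by
      rw [h1, ContinuousLinearMap.comp_apply, ContinuousLinearEquiv.coe_coe,
        ContinuousLinearEquiv.symm_apply_apply]
      exact balancedLift_btmul hbal a (M.mapA t)
    rw [h2, ContinuousLinearMap.flip_apply, hΦ]
  have hinv : σ.comp M.mapA = ContinuousLinearMap.id ℂ M.TensorA := by
    refine balancedTensor_ext fun p q => ?_
    have h1 : σ.comp (M.mapA.comp (M.tmulA.flip q)) = M.tmulA.flip q := by
      have h2 : (Submodule.span ℂ {p | ∃ a p', p = M.modP.lact a p'}).topologicalClosure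
          ≤ (σ.comp (M.mapA.comp (M.tmulA.flip q)) - M.tmulA.flip q).ker := by
        refine Submodule.topologicalClosure_minimal _ (Submodule.span_le.2 ?_)
          (ContinuousLinearMap.isClosed_ker _)
        rintro _ ⟨a, p', rfl⟩
        change σ (M.mapA (M.tmulA (M.modP.lact a p') q)) - M.tmulA (M.modP.lact a p') q = 0
        rw [← leftA_tmulA, mapA_leftA, hσ, sub_self]
      ext p
      have h3 := h2 (hP ▸ Submodule.mem_top : p ∈ _)
      exact sub_eq_zero.1 h3
    exact DFunLike.congr_fun h1 p
  refine ⟨ContinuousLinearEquiv.ofBijective M.mapA (LinearMap.ker_eq_bot.2 fun s t hst => ?_)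
    (LinearMap.range_eq_top.2 hM), ContinuousLinearEquiv.coe_ofBijective _ _ _⟩
  have h := congrArg σ hst
  have hid : ∀ t, σ (M.mapA t) = t := fun t => DFunLike.congr_fun hinv t
  exact (hid s).symm.trans (h.trans (hid t))

end MoritaContext

/-! ### Surjectivity onto a self-induced algebra -/

section SelfInduced

variable {B : Type*} [NonUnitalNormedRing B] [NormedSpace ℂ B] [IsScalarTower ℂ B B]
  [SMulCommClass ℂ B B] [CompleteSpace B]

theorem SelfInduced.mul_surjective (hB : SelfInduced B) :
    Function.Surjective (projLift (ContinuousLinearMap.mul ℂ B)) := by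
  obtain ⟨μ, hμ⟩ := hB
  refine (balancedLift_surjective_iff (M := RightBanachModule.self B)
    (N := LeftBanachModule.self B) fun p a q => mul_assoc p a q).1 ?_
  change Function.Surjective (mulMap B)
  rw [← hμ]
  exact μ.surjective

/-- Let `f` implement a surjection `Q ⊗̂ P → B` onto a self-induced Banach algebra. An operator `S`
whose range contains all `b₁ f(q, p) b₃` is surjective: by `projLift_mem_range` its range contains
successively all `b₁ b₂ b₃`, all `b₁ b` and all `b`. -/
theorem SelfInduced.surjective_of_mul_mem_range (hB : SelfInduced B) {P Q W : Type*}
    [NormedAddCommGroup P] [NormedSpace ℂ P] [CompleteSpace P]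
    [NormedAddCommGroup Q] [NormedSpace ℂ Q] [CompleteSpace Q]
    [NormedAddCommGroup W] [NormedSpace ℂ W] [CompleteSpace W]
    {f : Q →L[ℂ] P →L[ℂ] B} (hf : Function.Surjective (projLift f)) (S : W →L[ℂ] B)
    (h : ∀ b₁ q p b₃, ∃ w, S w = b₁ * (f q p * b₃)) : Function.Surjective S := by
  have h1 : ∀ b₁ b₂ b₃ : B, ∃ w, S w = b₁ * (b₂ * b₃) := by
    intro b₁ b₂ b₃
    obtain ⟨t, rfl⟩ := hf b₂
    exact projLift_mem_range S ((ContinuousLinearMap.mul ℂ B b₁).comp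
      ((ContinuousLinearMap.mul ℂ B).flip b₃)) f (fun q p => h b₁ q p b₃) t
  have h2 : ∀ b₁ b : B, ∃ w, S w = b₁ * b := by
    intro b₁ b
    obtain ⟨t, rfl⟩ := hB.mul_surjective b
    exact projLift_mem_range S (ContinuousLinearMap.mul ℂ B b₁) (ContinuousLinearMap.mul ℂ B)
      (h1 b₁) t
  intro b
  obtain ⟨t, rfl⟩ := hB.mul_surjective b
  exact projLift_mem_range S (ContinuousLinearMap.id ℂ B) (ContinuousLinearMap.mul ℂ B) h2 t

end SelfInduced

/-! ### Approximable operators and rank one operators -/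

section Approximable

variable {X Y Z : Type*} [NormedAddCommGroup X] [NormedSpace ℂ X]
  [NormedAddCommGroup Y] [NormedSpace ℂ Y] [NormedAddCommGroup Z] [NormedSpace ℂ Z]

theorem comp_mem_approximable_of_right (S : Y →L[ℂ] Z) {T : X →L[ℂ] Y}
    (hT : T ∈ approximable X Y) : S.comp T ∈ approximable X Z := by
  refine map_mem_closure (f := fun T : X →L[ℂ] Y => S.comp T)
    (ContinuousLinearMap.compL ℂ X Y Z S).continuous hT fun T hT => ?_
  have hT' : FiniteDimensional ℂ (LinearMap.range (T : X →ₗ[ℂ] Y)) := hT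
  refine Submodule.finiteDimensional_of_le
    (S₂ := (LinearMap.range (T : X →ₗ[ℂ] Y)).map (S : Y →ₗ[ℂ] Z)) ?_
  rintro _ ⟨x, rfl⟩
  exact ⟨T x, ⟨x, rfl⟩, rfl⟩

theorem finiteRank_le_approximable : finiteRank X Y ≤ approximable X Y :=
  Submodule.le_topologicalClosure _

theorem smulRight_mem_approximable (f : X →L[ℂ] ℂ) (y : Y) :
    f.smulRight y ∈ approximable X Y := by
  refine finiteRank_le_approximable (Submodule.finiteDimensional_of_le
    (S₂ := Submodule.span ℂ {y}) ?_)
  rintro _ ⟨x, rfl⟩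
  exact Submodule.smul_mem _ _ (Submodule.mem_span_singleton_self y)

/-- The rank one operators `y ⊗ f : x ↦ f x • y` with `f` fixed, depending linearly on `y`. -/
noncomputable def rankOne (f : X →L[ℂ] ℂ) : Y →L[ℂ] Approx X Y :=
  (ContinuousLinearMap.smulRightL ℂ X Y f).codRestrict (approximable X Y)
    (smulRight_mem_approximable f)

@[simp]
theorem rankOne_apply (f : X →L[ℂ] ℂ) (y : Y) (x : X) :
    (rankOne f y : X →L[ℂ] Y) x = f x • y := rfl

@[simp]
theorem coe_approx_mul (S T : Approx X X) :
    ((S * T : Approx X X) : X →L[ℂ] X) = (S : X →L[ℂ] X).comp (T : X →L[ℂ] X) := rfl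

theorem approx_ext {S T : Approx X Y}
    (h : ∀ x, (S : X →L[ℂ] Y) x = (T : X →L[ℂ] Y) x) : S = T :=
  Subtype.ext (ContinuousLinearMap.ext h)

theorem mul_rankOne (S : Approx X X) (f : X →L[ℂ] ℂ) (x : X) :
    S * rankOne f x = rankOne f ((S : X →L[ℂ] X) x) :=
  approx_ext fun z => by simp

/-- An idempotent `e` of `𝒜(X)` with `e 𝒜(X) e = ℂ e` has rank one. -/
theorem exists_eq_rankOne_of_corner {e : Approx X X} (he : e ≠ 0) (hee : e * e = e)
    (hcorner : ∀ a, ∃ c : ℂ, e * a * e = c • e) :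
    ∃ (x₀ : X) (f₀ : X →L[ℂ] ℂ), e = rankOne f₀ x₀ := by
  obtain ⟨z, hz⟩ : ∃ z, (e : X →L[ℂ] X) z ≠ 0 := by
    by_contra! h
    exact he (approx_ext h)
  obtain ⟨φ, hφ⟩ := SeparatingDual.exists_eq_one (R := ℂ) hz
  have hez : (e : X →L[ℂ] X) ((e : X →L[ℂ] X) z) = (e : X →L[ℂ] X) z := by
    conv_rhs => rw [← hee]
    rfl
  refine ⟨(e : X →L[ℂ] X) z, φ.comp (e : X →L[ℂ] X), approx_ext fun x => ?_⟩
  -- Evaluate `e (x ⊗ φ) e = c • e` at `e z`.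
  obtain ⟨c, hc⟩ := hcorner (rankOne φ x)
  have h := congrArg (fun T : Approx X X => (T : X →L[ℂ] X) ((e : X →L[ℂ] X) z)) hc
  simp only [coe_approx_mul, ContinuousLinearMap.comp_apply, hez, rankOne_apply, hφ, one_smul,
    Submodule.coe_smul, smul_apply] at h
  rw [rankOne_apply, ContinuousLinearMap.comp_apply, h, map_smul, hφ, smul_eq_mul, mul_one]

/-- The operators `a ∘ p` with `a ∈ 𝒜(X)` span a dense subspace of `𝒜(Y, X)`: a finite rank
operator `p` equals `a ∘ p` for any finite rank projection `a` onto its range. -/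
theorem approxComp_span_dense :
    (Submodule.span ℂ {p | ∃ (a : Approx X X) (p' : Approx Y X),
      p = approxComp Y X X a p'}).topologicalClosure = ⊤ := by
  rw [eq_top_iff]
  intro p _
  have hp : (p : Y →L[ℂ] X) ∈ closure (finiteRank Y X : Set (Y →L[ℂ] X)) := p.2
  change p ∈ closure _
  rw [closure_subtype]
  refine closure_mono (fun T hT => ?_) hp
  have : FiniteDimensional ℂ (LinearMap.range (T : Y →ₗ[ℂ] X)) := hT
  obtain ⟨π, hπ⟩ := Submodule.ClosedComplemented.of_finiteDimensional (𝕜 := ℂ)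
    (LinearMap.range (T : Y →ₗ[ℂ] X))
  let a : X →L[ℂ] X := (Submodule.subtypeL _).comp π
  have ha : a ∈ approximable X X := by
    refine finiteRank_le_approximable (Submodule.finiteDimensional_of_le
      (S₂ := LinearMap.range (T : Y →ₗ[ℂ] X)) ?_)
    rintro _ ⟨x, rfl⟩
    exact (π x).2
  refine ⟨⟨T, finiteRank_le_approximable hT⟩, Submodule.subset_span
    ⟨⟨a, ha⟩, ⟨T, finiteRank_le_approximable hT⟩, approx_ext fun y => ?_⟩, rfl⟩
  exact (congrArg Subtype.val (hπ ⟨T y, y, rfl⟩)).symm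

end Approximable

/-! ### The Morita context of operators between two Banach spaces -/

section OperatorContext

variable (X Y : Type*) [NormedAddCommGroup X] [NormedSpace ℂ X]
  [NormedAddCommGroup Y] [NormedSpace ℂ Y]

/-- The Morita context for `𝒜(X)` and `𝒜(Y)` on `𝒜(Y, X)` and `𝒜(X, Y)`, in which all actions and
pairings are composition of operators. -/
noncomputable def operatorContext :
    MoritaContext (Approx X X) (Approx Y Y) (Approx Y X) (Approx X Y) where
  modP :=
    { lact := approxComp Y X X
      lact_mul := fun _ _ _ => rfl
      ract := approxComp Y Y X
      ract_mul := fun _ _ _ => rfl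
      lact_ract := fun _ _ _ => rfl }
  modQ :=
    { lact := approxComp X Y Y
      lact_mul := fun _ _ _ => rfl
      ract := approxComp X X Y
      ract_mul := fun _ _ _ => rfl
      lact_ract := fun _ _ _ => rfl }
  pairA := approxComp X Y X
  pairB := approxComp Y X Y
  pairA_balanced _ _ _ := rfl
  pairB_balanced _ _ _ := rfl
  pairA_left _ _ _ := rfl
  pairA_right _ _ _ := rfl
  pairB_left _ _ _ := rfl
  pairB_right _ _ _ := rfl
  compat_P _ _ _ := rfl
  compat_Q _ _ _ := rfl

theorem operatorContext_mapA_isInvertible [CompleteSpace X]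
    (hX : SelfInduced (Approx X X)) (h : Function.Surjective (compMap X Y)) :
    (operatorContext X Y).mapA.IsInvertible :=
  (operatorContext X Y).mapA_isInvertible hX
    ((balancedLift_surjective_iff (operatorContext X Y).pairA_balanced).2 h)
    approxComp_span_dense

end OperatorContext

/-! ### Factoring the pairing of a full Morita context through operators -/

section Factoring

variable {X Y P Q : Type*} [NormedAddCommGroup X] [NormedSpace ℂ X]
  [NormedAddCommGroup Y] [NormedSpace ℂ Y]
  [NormedAddCommGroup P] [NormedSpace ℂ P] [NormedAddCommGroup Q] [NormedSpace ℂ Q]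

/-- If the pairing `Q ⊗̂ P → 𝒜(Y)` is onto, a rank one idempotent `u` of `𝒜(Y)` is of the form
`[q, p]` with `u.q = q` and `p.u = p`, because `u 𝒜(Y) u = ℂ u`. -/
theorem MoritaContext.exists_pairB_eq_rankOne [CompleteSpace Y]
    (M : MoritaContext (Approx X X) (Approx Y Y) P Q)
    (hM : Function.Surjective (projLift M.pairB)) {y₀ : Y} {g₀ : Y →L[ℂ] ℂ} (hg : g₀ y₀ = 1) :
    ∃ q p, M.pairB q p = rankOne g₀ y₀ ∧ M.modQ.lact (rankOne g₀ y₀) q = q ∧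
      M.modP.ract p (rankOne g₀ y₀) = p := by
  set u : Approx Y Y := rankOne g₀ y₀ with hu
  have huu : u * u = u := by
    rw [hu, mul_rankOne, rankOne_apply, hg, one_smul]
  have hcorner : ∀ b : Approx Y Y, u * b * u = g₀ ((b : Y →L[ℂ] Y) y₀) • u := fun b => by
    rw [mul_assoc, hu, mul_rankOne, mul_rankOne, rankOne_apply, map_smul]
  -- The functional `b ↦ g₀ (b y₀)` is nonzero at `u`, hence at some `[q₁, p₁]`.
  obtain ⟨q₁, p₁, hc⟩ : ∃ q₁ p₁, g₀ ((M.pairB q₁ p₁ : Y →L[ℂ] Y) y₀) ≠ 0 := by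
    by_contra! h
    let ψ : Approx Y Y →L[ℂ] ℂ :=
      g₀.comp ((ContinuousLinearMap.apply ℂ Y y₀).comp (approximable Y Y).subtypeL)
    have hψ : ψ.comp (projLift M.pairB) = 0 := projTensor_ext fun q p => by
      rw [ContinuousLinearMap.comp_apply, projLift_ptmul]
      exact h q p
    obtain ⟨t, ht⟩ := hM u
    have h0 : ψ u = 0 := by
      rw [← ht]
      exact DFunLike.congr_fun hψ t
    have h1 : ψ u = g₀ (g₀ y₀ • y₀) := rfl
    simp [h1, hg] at h0
  refine ⟨(g₀ ((M.pairB q₁ p₁ : Y →L[ℂ] Y) y₀))⁻¹ • M.modQ.lact u q₁, M.modP.ract p₁ u,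
    ?_, ?_, ?_⟩
  · rw [map_smul, smul_apply, M.pairB_right, M.pairB_left, hcorner,
      inv_smul_smul₀ hc]
  · rw [map_smul, ← M.modQ.lact_mul, huu]
  · rw [← M.modP.ract_mul, huu]

/-- If the pairing `Q ⊗̂ P → 𝒜(Y)` of a Morita context for `𝒜(X)` and `𝒜(Y)` is onto, then every
`[q', p']` factors through `X`.

Let `u = y₀ ⊗ g₀ = [q, p]` be a rank one idempotent as in `exists_pairB_eq_rankOne`. Then
`{p, q}` is a rank one idempotent `x₀ ⊗ f₀` of `𝒜(X)`, and the factors are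
`x ↦ [q'.(x ⊗ f₀), p] y₀` and `y ↦ {p'.(y ⊗ g₀), q} x₀`. -/
theorem MoritaContext.exists_pairB_eq_comp [CompleteSpace Y]
    (M : MoritaContext (Approx X X) (Approx Y Y) P Q)
    (hM : Function.Surjective (projLift M.pairB)) (q' : Q) (p' : P) :
    ∃ (S : X →L[ℂ] Y) (T : Y →L[ℂ] X), (M.pairB q' p' : Y →L[ℂ] Y) = S.comp T := by
  rcases subsingleton_or_nontrivial Y with hY | hY
  · exact ⟨0, 0, ContinuousLinearMap.ext fun y => Subsingleton.elim _ _⟩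
  obtain ⟨y₀, hy₀⟩ := exists_ne (0 : Y)
  obtain ⟨g₀, hg⟩ := SeparatingDual.exists_eq_one (R := ℂ) hy₀
  obtain ⟨q, p, hqp, huq, hpu⟩ := M.exists_pairB_eq_rankOne hM hg
  set u : Approx Y Y := rankOne g₀ y₀ with hu
  have huy : (u : Y →L[ℂ] Y) y₀ = y₀ := by rw [hu, rankOne_apply, hg, one_smul]
  have huu : u * u = u := by rw [hu, mul_rankOne, ← hu, huy]
  have hu0 : u ≠ 0 := fun h => hy₀ (by rw [← huy, h]; rfl)
  have hqe : M.modQ.ract q (M.pairA p q) = q := by rw [← M.compat_Q, hqp, huq]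
  have hcorner : ∀ a, ∃ c : ℂ, M.pairA p q * a * M.pairA p q = c • M.pairA p q := by
    intro a
    refine ⟨g₀ ((M.pairB (M.modQ.ract q a) p : Y →L[ℂ] Y) y₀), ?_⟩
    have h : ∀ b : Approx Y Y, M.pairA p (M.modQ.lact b q)
        = g₀ ((b : Y →L[ℂ] Y) y₀) • M.pairA p q := fun b => by
      have h1 : u * b * u = g₀ ((b : Y →L[ℂ] Y) y₀) • u := by
        rw [mul_assoc, hu, mul_rankOne, mul_rankOne, rankOne_apply, map_smul]
      conv_lhs => rw [← hpu, ← huq]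
      rw [M.pairA_balanced, ← M.modQ.lact_mul, ← M.modQ.lact_mul, h1, map_smul,
        smul_apply, huq, map_smul]
    rw [← M.pairA_right, ← M.pairA_right, ← M.compat_Q, h]
  obtain ⟨x₀, f₀, he⟩ : ∃ (x₀ : X) (f₀ : X →L[ℂ] ℂ), M.pairA p q = rankOne f₀ x₀ := by
    refine exists_eq_rankOne_of_corner (fun h => hu0 ?_) ?_ hcorner
    · rw [← hqp, ← hqe, h, map_zero, map_zero]
      rfl
    · rw [← M.pairA_right, hqe]
  refine ⟨((ContinuousLinearMap.apply ℂ Y y₀).comp (approximable Y Y).subtypeL).comp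
      ((M.pairB.flip p).comp ((M.modQ.ract q').comp (rankOne f₀))),
    ((ContinuousLinearMap.apply ℂ X x₀).comp (approximable X X).subtypeL).comp
      ((M.pairA.flip q).comp ((M.modP.ract p').comp (rankOne g₀))), ?_⟩
  ext y
  change (M.pairB q' p' : Y →L[ℂ] Y) y = (M.pairB (M.modQ.ract q' (rankOne f₀
    ((M.pairA (M.modP.ract p' (rankOne g₀ y)) q : X →L[ℂ] X) x₀))) p : Y →L[ℂ] Y) y₀
  rw [← mul_rankOne, ← he, ← M.pairA_right, hqe, ← M.compat_Q, M.pairB_left, hqp, M.pairB_right,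
    coe_approx_mul, coe_approx_mul, ContinuousLinearMap.comp_apply, huy,
    ContinuousLinearMap.comp_apply, rankOne_apply, hg, one_smul]

/-- If the pairing `Q ⊗̂ P → 𝒜(Y)` of a Morita context for `𝒜(X)` and `𝒜(Y)` is onto and `𝒜(Y)` is
self-induced, then composition `𝒜(X, Y) ⊗̂ 𝒜(Y, X) → 𝒜(Y)` is onto.

The factors `S`, `T` of `[q, p] = S ∘ T` need not be approximable, but `b₁ ∘ S` and `T ∘ b₃` are. -/
theorem MoritaContext.compMap_surjective [CompleteSpace X] [CompleteSpace Y] [CompleteSpace P]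
    [CompleteSpace Q] (M : MoritaContext (Approx X X) (Approx Y Y) P Q)
    (hM : Function.Surjective (projLift M.pairB)) (hY : SelfInduced (Approx Y Y)) :
    Function.Surjective (compMap Y X) := by
  refine hY.surjective_of_mul_mem_range hM (compMap Y X) fun b₁ q p b₃ => ?_
  obtain ⟨S, T, hST⟩ := M.exists_pairB_eq_comp hM q p
  refine ⟨ptmul (⟨(b₁ : Y →L[ℂ] Y).comp S, comp_mem_approximable b₁.2 S⟩ : Approx X Y)
    (⟨T.comp (b₃ : Y →L[ℂ] Y), comp_mem_approximable_of_right T b₃.2⟩ : Approx Y X), ?_⟩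
  rw [compMap, projLift_ptmul]
  refine approx_ext fun y => ?_
  rw [coe_approx_mul, coe_approx_mul, hST]
  rfl

end Factoring

end BanachMorita

theorem theorem3p2 (X : Type*) (Y : Type*)
    [NormedAddCommGroup X] [NormedSpace ℂ X] [CompleteSpace X]
    [NormedAddCommGroup Y] [NormedSpace ℂ Y] [CompleteSpace Y]
    (hX : BanachMorita.SelfInduced (BanachMorita.Approx X X))
    (hY : BanachMorita.SelfInduced (BanachMorita.Approx Y Y)) :
    BanachMorita.MoritaEquivalent (BanachMorita.Approx X X) (BanachMorita.Approx Y Y) ↔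
      (Function.Surjective (BanachMorita.compMap Y X) ∧
        Function.Surjective (BanachMorita.compMap X Y)) := by
  open BanachMorita in
  constructor
  · rintro ⟨P, Q, _, _, _, _, _, _, M, ⟨α, hα⟩, ⟨β, hβ⟩⟩
    have hA : Function.Surjective (projLift M.pairA) :=
      (balancedLift_surjective_iff M.pairA_balanced).1 (by
        change Function.Surjective M.mapA
        rw [← hα]
        exact α.surjective)
    have hB : Function.Surjective (projLift M.pairB) :=
      (balancedLift_surjective_iff M.pairB_balanced).1 (by
        change Function.Surjective M.mapB
        rw [← hβ]
        exact β.surjective)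
    exact ⟨M.compMap_surjective hB hY, M.symm.compMap_surjective hA hX⟩
  · rintro ⟨h₁, h₂⟩
    exact ⟨Approx Y X, Approx X Y, inferInstance, inferInstance, inferInstance, inferInstance,
      inferInstance, inferInstance, operatorContext X Y,
      operatorContext_mapA_isInvertible X Y hX h₂, operatorContext_mapA_isInvertible Y X hY h₁⟩
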